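/- **Theorem (Local Asymptotic Stability).** Let $N$ be the number of streamers, let $\alpha_i,p_i,\eta_i$ ($1\le i\le N$) and $\beta,M,\tau,R,\gamma$ be real parameters, let $Q\subseteq\mathbb R$ be the open set of admissible quality levels, and let the cost function $c:Q\to\mathbb R$ be twice continuously differentiable. For $n=(n_1,\dots,n_N)\in\mathbb R^N$ (viewer numbers) and $q=(q_1,\dots,q_N)\in Q^N$ (content qualities) put $$P_i(n,q)=\frac{\exp(\alpha_i q_i-p_i+\beta n_i)}{\sum_{k=1}^N\exp(\alpha_k q_k-p_k+\beta n_k)},$$ and consider on $\mathbb R^N\times Q^N$ the system $$\frac{dn_i}{dt}=\gamma\bigl[M P_i(n,q)-n_i\bigr],\qquad \frac{dq_i}{dt}=\eta_i\Bigl[(1-\tau)R\,\frac{\partial (M P_i)}{\partial q_i}(n,q)-c'(q_i)\Bigr],\qquad 1\le i\le N,$$ where the partial derivative is taken with $n$ and all $q_k$, $k\ne i$, fixed (so it equals $M\alpha_iP_i(1-P_i)$). Let $(n^*,q^*)\in\mathbb R^N\times Q^N$ be a steady state, i.e. a zero of the right-hand side, and let $J$ be the $2N\times 2N$ Jacobian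 matrix of the right-hand side with respect to $(n,q)$, evaluated at $(n^*,q^*)$. If every complex eigenvalue $\lambda$ of $J$ satisfies $\operatorname{Re}\lambda<0$, then $(n^*,q^*)$ is locally asymptotically stable: every initial value sufficiently close to $(n^*,q^*)$ has a solution defined for all $t\ge 0$; for every $\varepsilon>0$ there is $\delta>0$ such that every solution on an interval $[0,T)$ that starts within distance $\delta$ of $(n^*,q^*)$ stays within distance $\varepsilon$ of it; and there is $\delta>0$ such that every solution on $[0,\infty)$ that starts within distance $\delta$ of $(n^*,q^*)$ converges to it as $t\to\infty$. -/

import Mathlib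

/-- `x` is a solution on the time set `s` of the autonomous ODE `x' = F x` posed on the domain
`D`: it stays in `D` and solves the equation (one-sided derivatives at end points of `s`). -/
def IsODESolutionOn {E : Type*} [NormedAddCommGroup E] [NormedSpace ℝ E]
    (F : E → E) (D : Set E) (x : ℝ → E) (s : Set ℝ) : Prop :=
  (∀ t ∈ s, x t ∈ D) ∧ IsIntegralCurveOn x (fun _ => F) s

/-- Local asymptotic stability of the point `e` for the ODE `x' = F x` on `D`: solutions starting
near `e` exist for all future times, `e` is Lyapunov stable, and `e` is locally attractive. -/
structure IsLocallyAsymptoticallyStable {E : Type*} [NormedAddCommGroup E] [NormedSpace ℝ E]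
    (F : E → E) (D : Set E) (e : E) : Prop where
  /-- Every initial value near `e` has a solution defined for all `t ≥ 0`. -/
  exists_solution : ∃ δ > 0, ∀ x₀ ∈ Metric.ball e δ,
    ∃ x : ℝ → E, x 0 = x₀ ∧ IsODESolutionOn F D x (Set.Ici 0)
  /-- Lyapunov stability. It is required of all solutions, on whatever interval `[0, T)`. -/
  stable : ∀ ε > 0, ∃ δ > 0, ∀ (T : ℝ) (x : ℝ → E), x 0 ∈ Metric.ball e δ →
    IsODESolutionOn F D x (Set.Ico 0 T) → ∀ t ∈ Set.Ico 0 T, x t ∈ Metric.ball e ε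
  /-- Local attractivity. -/
  attractive : ∃ δ > 0, ∀ x : ℝ → E, x 0 ∈ Metric.ball e δ →
    IsODESolutionOn F D x (Set.Ici 0) → Filter.Tendsto x Filter.atTop (nhds e)

/-- The data of the viewer/quality model with `N` streamers. -/
structure StreamingModel (N : ℕ) where
  /-- intrinsic attractiveness of each streamer -/
  α : Fin N → ℝ
  /-- price of each streamer -/
  p : Fin N → ℝ
  /-- network-effect parameter -/
  β : ℝ
  /-- total number of viewers -/
  M : ℝ
  /-- commission rate -/
  τ : ℝ
  /-- average revenue per viewer -/
  R : ℝ
  /-- adjustment rate of the viewers -/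
  γ : ℝ
  /-- adjustment rate of the quality of each streamer -/
  η : Fin N → ℝ
  /-- admissible quality levels, for instance `(0, ∞)` or all of `ℝ` -/
  Q : Set ℝ
  /-- cost of quality; only its values on `Q` matter -/
  c : ℝ → ℝ
  isOpen_Q : IsOpen Q
  contDiffOn_c : ContDiffOn ℝ 2 c Q

namespace StreamingModel

noncomputable section

variable {N : ℕ} (m : StreamingModel N)

/-- The multinomial logit probability `P_i` of choosing streamer `i`, given the viewer numbers `n`
and the qualities `q`. -/
def choiceProb (n q : Fin N → ℝ) (i : Fin N) : ℝ :=
  Real.exp (m.α i * q i - m.p i + m.β * n i) /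
    ∑ k, Real.exp (m.α k * q k - m.p k + m.β * n k)

/-- The marginal audience `∂n_i/∂q_i`: the partial derivative of `M * P_i` with respect to `q_i`,
all other variables being fixed. -/
def marginalAudience (n q : Fin N → ℝ) (i : Fin N) : ℝ :=
  deriv (fun s => m.M * m.choiceProb n (Function.update q i s) i) (q i)

/-- Right-hand side of the equation for `dn_i/dt`. -/
def viewerRate (n q : Fin N → ℝ) (i : Fin N) : ℝ :=
  m.γ * (m.M * m.choiceProb n q i - n i)

/-- Right-hand side of the equation for `dq_i/dt`. -/
def qualityRate (n q : Fin N → ℝ) (i : Fin N) : ℝ :=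
  m.η i * ((1 - m.τ) * m.R * m.marginalAudience n q i - deriv m.c (q i))

/-- The vector field of the coupled system on states `(n, q)`. -/
def vectorField (x : (Fin N → ℝ) × (Fin N → ℝ)) : (Fin N → ℝ) × (Fin N → ℝ) :=
  (m.viewerRate x.1 x.2, m.qualityRate x.1 x.2)

/-- The states: all qualities are admissible. -/
def stateSpace : Set ((Fin N → ℝ) × (Fin N → ℝ)) :=
  {x | ∀ i, x.2 i ∈ m.Q}

/-- Steady states are the rest points of the coupled system. -/
def IsSteadyState (x : (Fin N → ℝ) × (Fin N → ℝ)) : Prop :=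
  x ∈ m.stateSpace ∧ m.vectorField x = 0

/-- The `2N × 2N` Jacobian matrix of the coupled system at the state `(n, q)`: the blocks of partial
derivatives `∂(dn_i/dt)/∂n_j`, `∂(dn_i/dt)/∂q_j`, `∂(dq_i/dt)/∂n_j`, `∂(dq_i/dt)/∂q_j`. -/
def jacobian (n q : Fin N → ℝ) : Matrix (Fin N ⊕ Fin N) (Fin N ⊕ Fin N) ℝ :=
  Matrix.fromBlocks
    (Matrix.of fun i j => deriv (fun s => m.viewerRate (Function.update n j s) q i) (n j))
    (Matrix.of fun i j => deriv (fun s => m.viewerRate n (Function.update q j s) i) (q j))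
    (Matrix.of fun i j => deriv (fun s => m.qualityRate (Function.update n j s) q i) (n j))
    (Matrix.of fun i j => deriv (fun s => m.qualityRate n (Function.update q j s) i) (q j))

end

end StreamingModel

/-!
In a suitable inner product, a linear map whose eigenvalues all have real part less than `ω`
satisfies `re ⟪v, T v⟫ ≤ ω' ‖v‖ ^ 2` for some `ω' < ω`. By induction on the dimension, split off a
left eigenvector `φ`: on `ker φ` the inner product is already known, and giving the complementary
direction a large weight makes the off-diagonal term of the block triangular `T` harmless. For the
derivative of `F` at a rest point `e` one may take `ω = 0`, and near `e` the remainder of `F` costs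
an arbitrarily small part of `ω'`. Hence `‖x t - e‖` decays exponentially in this inner product:
small balls about `e` are invariant, so local solutions can be concatenated forever. Stability being
invariant under linear isomorphisms, it passes to the given norm.
-/

open Filter Module Set Topology
open scoped InnerProductSpace

section LogNorm

variable {𝕜 V H H₁ H₂ : Type*} [RCLike 𝕜] [AddCommGroup V] [Module 𝕜 V]
  [NormedAddCommGroup H] [InnerProductSpace 𝕜 H] [NormedAddCommGroup H₁] [InnerProductSpace 𝕜 H₁]
  [NormedAddCommGroup H₂] [InnerProductSpace 𝕜 H₂]

/-- The logarithmic norm of `T`, for the (semi-)inner product pulled back along `f`, is at most `ω`.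
Inner products on `V` are encoded as linear maps into inner product spaces, so that a new one can be
built by mapping into a product. -/
def LogNormLE (f : V →ₗ[𝕜] H) (T : End 𝕜 V) (ω : ℝ) : Prop :=
  ∀ v, RCLike.re ⟪f v, f (T v)⟫_𝕜 ≤ ω * ‖f v‖ ^ 2

theorem exists_linearEquiv_euclideanSpace_inner_eq [FiniteDimensional 𝕜 V] {f : V →ₗ[𝕜] H}
    (hf : Function.Injective f) :
    ∃ L : V ≃ₗ[𝕜] EuclideanSpace 𝕜 (Fin (finrank 𝕜 V)), ∀ v w, ⟪L v, L w⟫_𝕜 = ⟪f v, f w⟫_𝕜 := by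
  let b := (stdOrthonormalBasis 𝕜 f.range).reindex (finCongr (LinearMap.finrank_range_of_inj hf))
  refine ⟨(LinearEquiv.ofInjective f hf).trans b.repr.toLinearEquiv, fun v w => ?_⟩
  exact b.repr.inner_map_map _ _

theorem LogNormLE.exists_linearEquiv [FiniteDimensional 𝕜 V] {f : V →ₗ[𝕜] H} {T : End 𝕜 V}
    {ω : ℝ} (hT : LogNormLE f T ω) (hf : Function.Injective f) :
    ∃ L : V ≃ₗ[𝕜] EuclideanSpace 𝕜 (Fin (finrank 𝕜 V)), LogNormLE L.toLinearMap T ω := by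
  obtain ⟨L, hL⟩ := exists_linearEquiv_euclideanSpace_inner_eq hf
  refine ⟨L, fun v => ?_⟩
  simpa only [LinearEquiv.coe_coe, hL, ← inner_self_eq_norm_sq (𝕜 := 𝕜)] using hT v

theorem logNormLE_of_apply_eq_mul {φ : Dual 𝕜 V} {T : End 𝕜 V} {μ : 𝕜}
    (hφ : ∀ v, φ (T v) = μ * φ v) : LogNormLE φ T (RCLike.re μ) := fun v => by
  rw [hφ, ← smul_eq_mul, inner_smul_right, inner_self_eq_norm_sq_to_K, ← RCLike.ofReal_pow,
    RCLike.re_mul_ofReal]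

theorem exists_weight_absorbing_cross_term {ω₁ ω₂ ω : ℝ} (h₁ : ω₁ < ω) (h₂ : ω₂ < ω) (C : ℝ) :
    ∃ κ > 0, ∀ a b : ℝ,
      ω₁ * a ^ 2 + C * a * b + κ ^ 2 * (ω₂ * b ^ 2) ≤ ω * (a ^ 2 + κ ^ 2 * b ^ 2) := by
  set d := 4 * (ω - ω₁) * (ω - ω₂)
  have hd : 0 < d := mul_pos (mul_pos four_pos (sub_pos.mpr h₁)) (sub_pos.mpr h₂)
  have hκ : 0 < C ^ 2 / d + 1 := by positivity
  refine ⟨√(C ^ 2 / d + 1), Real.sqrt_pos.mpr hκ, fun a b => ?_⟩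
  rw [Real.sq_sqrt hκ.le]
  have hsq : 4 * (ω - ω₁) * (ω * (a ^ 2 + (C ^ 2 / d + 1) * b ^ 2) -
      (ω₁ * a ^ 2 + C * a * b + (C ^ 2 / d + 1) * (ω₂ * b ^ 2))) =
      (2 * (ω - ω₁) * a - C * b) ^ 2 + d * b ^ 2 := by
    have hC : d * (C ^ 2 / d) = C ^ 2 := mul_div_cancel₀ _ hd.ne'
    linear_combination b ^ 2 * hC
  have hnonneg : 0 ≤ (2 * (ω - ω₁) * a - C * b) ^ 2 + d * b ^ 2 := by positivity
  exact sub_nonneg.mp (nonneg_of_mul_nonneg_right (hsq ▸ hnonneg)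
    (mul_pos four_pos (sub_pos.mpr h₁)))

theorem exists_logNormLE_prod_smul {f : V →ₗ[𝕜] H₁} {g : V →ₗ[𝕜] H₂} {T : End 𝕜 V}
    {ω₁ ω₂ ω C : ℝ} (h₁ : ω₁ < ω) (h₂ : ω₂ < ω)
    (hf : ∀ v, RCLike.re ⟪f v, f (T v)⟫_𝕜 ≤ ω₁ * ‖f v‖ ^ 2 + C * ‖f v‖ * ‖g v‖)
    (hg : LogNormLE g T ω₂) :
    ∃ κ : ℝ, 0 < κ ∧ LogNormLE
      ((WithLp.linearEquiv 2 𝕜 (H₁ × H₂)).symm.toLinearMap ∘ₗ f.prod ((κ : 𝕜) • g)) T ω := by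
  obtain ⟨κ, hκ, hκC⟩ := exists_weight_absorbing_cross_term h₁ h₂ C
  refine ⟨κ, hκ, fun v => ?_⟩
  have hinner : RCLike.re ⟪(κ : 𝕜) • g v, (κ : 𝕜) • g (T v)⟫_𝕜 =
      κ ^ 2 * RCLike.re ⟪g v, g (T v)⟫_𝕜 := by
    rw [inner_smul_left, inner_smul_right, RCLike.conj_ofReal, RCLike.re_ofReal_mul,
      RCLike.re_ofReal_mul, sq, mul_assoc]
  have hnorm : ‖(κ : 𝕜) • g v‖ ^ 2 = κ ^ 2 * ‖g v‖ ^ 2 := by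
    rw [norm_smul, mul_pow, RCLike.norm_ofReal, sq_abs]
  calc RCLike.re (⟪f v, f (T v)⟫_𝕜 + ⟪(κ : 𝕜) • g v, (κ : 𝕜) • g (T v)⟫_𝕜)
      = RCLike.re ⟪f v, f (T v)⟫_𝕜 + κ ^ 2 * RCLike.re ⟪g v, g (T v)⟫_𝕜 := by
        rw [map_add, hinner]
    _ ≤ ω₁ * ‖f v‖ ^ 2 + C * ‖f v‖ * ‖g v‖ + κ ^ 2 * (ω₂ * ‖g v‖ ^ 2) := by
        gcongr
        exacts [hf v, hg v]
    _ ≤ ω * (‖f v‖ ^ 2 + κ ^ 2 * ‖g v‖ ^ 2) := hκC _ _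
    _ = _ := by
        rw [WithLp.prod_norm_sq_eq_of_L2, ← hnorm]
        rfl

end LogNorm

section AdaptedInnerProduct

theorem exists_hasEigenvalue_dual_comp_eq_smul {K V : Type*} [Field K] [IsAlgClosed K]
    [AddCommGroup V] [Module K V] [FiniteDimensional K V] [Nontrivial V] (T : End K V) :
    ∃ μ, T.HasEigenvalue μ ∧ ∃ φ : Dual K V, φ ≠ 0 ∧ ∀ v, φ (T v) = μ * φ v := by
  obtain ⟨μ, hμ⟩ := End.exists_eigenvalue T
  have hrange : (T - algebraMap K (End K V) μ).range ≠ ⊤ := fun h =>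
    End.hasEigenvalue_iff.mp hμ <|
      End.eigenspace_def.trans (LinearMap.ker_eq_bot_iff_range_eq_top.mpr h)
  obtain ⟨φ, hφ, hle⟩ := Submodule.exists_le_ker_of_lt_top _ hrange.lt_top
  refine ⟨μ, hμ, φ, hφ, fun v => ?_⟩
  simpa [sub_eq_zero] using hle (LinearMap.mem_range_self _ v)

theorem hasEigenvalue_of_hasEigenvalue_restrict {R V : Type*} [CommRing R] [AddCommGroup V]
    [Module R V] {T : End R V} {W : Submodule R V} (hW : ∀ w ∈ W, T w ∈ W) {μ : R}
    (hμ : End.HasEigenvalue (T.restrict hW) μ) : T.HasEigenvalue μ := by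
  rw [End.hasEigenvalue_iff] at hμ ⊢
  intro hbot
  have hmap := End.eigenspace_restrict_le_eigenspace T hW μ
  rw [hbot, le_bot_iff, ← Submodule.map_bot W.subtype] at hmap
  exact hμ (Submodule.map_injective_of_injective W.injective_subtype hmap)

theorem exists_ker_projection_apply_eq_restrict_add {K V : Type*} [Field K]
    [AddCommGroup V] [Module K V] {T : End K V} {φ : Dual K V} {μ : K}
    (hφ : φ ≠ 0) (hφT : ∀ v, φ (T v) = μ * φ v)
    (hker : ∀ w ∈ φ.ker, T w ∈ φ.ker) :
    ∃ (π : V →ₗ[K] φ.ker) (r : φ.ker), (∀ v, π v = 0 → φ v = 0 → v = 0) ∧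
      ∀ v, π (T v) = T.restrict hker (π v) + φ v • r := by
  obtain ⟨u, hu⟩ := LinearMap.surjective hφ 1
  let π : V →ₗ[K] φ.ker :=
    (LinearMap.id - φ.smulRight u).codRestrict φ.ker fun v => by simp [hu]
  have hπ : ∀ v, (π v : V) = v - φ v • u := fun v => rfl
  refine ⟨π, π (T u), fun v hv hφv => ?_, fun v => ?_⟩
  · simpa [hφv, hv] using (hπ v).symm
  · ext
    simp only [hπ, Submodule.coe_add, Submodule.coe_smul, LinearMap.coe_restrict_apply, hφT,
      map_sub, map_smul, hu]
    module

theorem exists_linearEquiv_logNormLE {V : Type*} [AddCommGroup V] [Module ℂ V]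
    [FiniteDimensional ℂ V] {T : End ℂ V} {ω : ℝ} (hT : ∀ μ, T.HasEigenvalue μ → μ.re < ω) :
    ∃ L : V ≃ₗ[ℂ] EuclideanSpace ℂ (Fin (finrank ℂ V)), ∃ ω' < ω,
      LogNormLE L.toLinearMap T ω' := by
  induction hd : finrank ℂ V using Nat.strong_induction_on generalizing V with
  | _ d ih =>
  subst hd
  rcases subsingleton_or_nontrivial V with hV | hV
  · refine ⟨.ofFinrankEq _ _ (by simp), ω - 1, sub_one_lt ω, fun v => ?_⟩
    simp [Subsingleton.elim v 0]
  obtain ⟨μ, hμ, φ, hφ, hφT⟩ := exists_hasEigenvalue_dual_comp_eq_smul T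
  have hker : ∀ w ∈ φ.ker, T w ∈ φ.ker := fun w hw => by
    rw [LinearMap.mem_ker] at hw ⊢
    rw [hφT, hw, mul_zero]
  have hlt : finrank ℂ φ.ker < finrank ℂ V :=
    Submodule.finrank_lt fun h => hφ (LinearMap.ker_eq_top.mp h)
  obtain ⟨L, ω₁, hω₁, hL⟩ := ih _ hlt
    (fun ν hν => hT ν (hasEigenvalue_of_hasEigenvalue_restrict hker hν)) rfl
  obtain ⟨π, r, hπφ, hπT⟩ := exists_ker_projection_apply_eq_restrict_add hφ hφT hker
  obtain ⟨ω', hω', hω'lt⟩ := exists_between (max_lt hω₁ (hT μ hμ))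
  have hcross : ∀ v, (⟪L (π v), L (π (T v))⟫_ℂ).re ≤
      ω₁ * ‖L (π v)‖ ^ 2 + ‖L r‖ * ‖L (π v)‖ * ‖φ v‖ := fun v => by
    rw [hπT, map_add, map_smul, inner_add_right, Complex.add_re]
    gcongr
    · exact hL (π v)
    · calc (⟪L (π v), φ v • L r⟫_ℂ).re ≤ ‖L (π v)‖ * ‖φ v • L r‖ :=
          re_inner_le_norm (𝕜 := ℂ) _ _
        _ = ‖L r‖ * ‖L (π v)‖ * ‖φ v‖ := by rw [norm_smul]; ring
  obtain ⟨κ, hκ, hlog⟩ := exists_logNormLE_prod_smul (f := L.toLinearMap ∘ₗ π)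
    ((le_max_left _ _).trans_lt hω') ((le_max_right _ _).trans_lt hω') hcross
    (logNormLE_of_apply_eq_mul hφT)
  obtain ⟨L', hL'⟩ := hlog.exists_linearEquiv <| (injective_iff_map_eq_zero _).mpr fun v hv => by
    simp_all [Prod.ext_iff, hκ.ne']
  exact ⟨L', ω', hω'lt, hL'⟩

theorem exists_linearEquiv_logNormLE_of_baseChange {E : Type*} [AddCommGroup E] [Module ℝ E]
    [FiniteDimensional ℝ E] {A : End ℝ E} {ω : ℝ}
    (hA : ∀ μ : ℂ, End.HasEigenvalue (A.baseChange ℂ) μ → μ.re < ω) :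
    ∃ L : E ≃ₗ[ℝ] EuclideanSpace ℝ (Fin (finrank ℝ E)), ∃ ω' < ω,
      LogNormLE L.toLinearMap A ω' := by
  obtain ⟨L, ω', hω', hL⟩ := exists_linearEquiv_logNormLE hA
  let f : E →ₗ[ℝ] EuclideanSpace ℂ (Fin (finrank ℂ (TensorProduct ℝ ℂ E))) :=
    (L.toLinearMap.restrictScalars ℝ) ∘ₗ TensorProduct.mk ℝ ℂ E 1
  have hf : Function.Injective f :=
    L.injective.comp (Module.FaithfullyFlat.tensorProduct_mk_injective (A := ℝ) (B := ℂ) E)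
  have hre : ∀ v w, ⟪f v, f w⟫_ℝ = (⟪f v, f w⟫_ℂ).re := fun v w => by simp [PiLp.inner_apply]
  have hfA : LogNormLE f A ω' := fun v => (hre v (A v)).trans_le (hL (1 ⊗ₜ v))
  obtain ⟨L', hL'⟩ := hfA.exists_linearEquiv hf
  exact ⟨L', ω', hω', hL'⟩

end AdaptedInnerProduct

section Solutions

variable {E E' : Type*} [NormedAddCommGroup E] [NormedSpace ℝ E] [NormedAddCommGroup E']
  [NormedSpace ℝ E'] {F : E → E} {D : Set E} {x : ℝ → E} {s : Set ℝ}

theorem IsODESolutionOn.mono {D' : Set E} {s' : Set ℝ} (hx : IsODESolutionOn F D x s)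
    (hD : D ⊆ D') (hs : s' ⊆ s) : IsODESolutionOn F D' x s' :=
  ⟨fun t ht => hD (hx.1 t (hs ht)), hx.2.mono hs⟩

theorem IsODESolutionOn.congr {y : ℝ → E} (hx : IsODESolutionOn F D x s) (hy : EqOn y x s) :
    IsODESolutionOn F D y s :=
  ⟨fun t ht => hy ht ▸ hx.1 t ht, fun t ht => by
    rw [hy ht]
    exact (hx.2 t ht).congr hy (hy ht)⟩

theorem IsODESolutionOn.comp_sub_const (hx : IsODESolutionOn F D x s) (a : ℝ) :
    IsODESolutionOn F D (fun t => x (t - a)) ((· - a) ⁻¹' s) := by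
  refine ⟨fun t ht => hx.1 _ ht, fun t ht => ?_⟩
  have hshift := ((hasDerivAt_id t).sub_const a).hasDerivWithinAt (s := (· - a) ⁻¹' s)
  simpa [Function.comp_def] using (hx.2 _ ht).scomp t hshift (mapsTo_preimage _ _)

theorem IsODESolutionOn.comp_continuousLinearMap {G : E' → E'} {D' : Set E'} {L : E →L[ℝ] E'}
    (hx : IsODESolutionOn F D x s) (hD : MapsTo L D D') (hL : ∀ y ∈ D, G (L y) = L (F y)) :
    IsODESolutionOn G D' (L ∘ x) s := by
  refine ⟨fun t ht => hD (hx.1 t ht), fun t ht => ?_⟩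
  exact (L.hasFDerivAt.comp_hasDerivWithinAt t (hx.2 t ht)).congr_deriv (hL _ (hx.1 t ht)).symm

theorem IsODESolutionOn.union {s' : Set ℝ} (hx : IsODESolutionOn F D x s)
    (hx' : IsODESolutionOn F D x s') (hs : IsClosed s) (hs' : IsClosed s') :
    IsODESolutionOn F D x (s ∪ s') := by
  have hderiv {u : Set ℝ} (hxu : IsODESolutionOn F D x u) (hu : IsClosed u) (t : ℝ) :
      HasDerivWithinAt x (F (x t)) u t := by
    by_cases ht : t ∈ u
    · exact hxu.2 t ht
    · exact HasFDerivWithinAt.of_notMem_closure (by rwa [hu.closure_eq])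
  exact ⟨fun t ht => ht.elim (hx.1 t) (hx'.1 t),
    fun t _ => (hderiv hx hs t).union (hderiv hx' hs' t)⟩

theorem IsODESolutionOn.Ici_of_forall_nat {h : ℝ} (hh : 0 < h)
    (hx : ∀ k : ℕ, IsODESolutionOn F D x (Icc (k * h) ((k + 1) * h))) :
    IsODESolutionOn F D x (Ici 0) := by
  have hIcc : ∀ k : ℕ, IsODESolutionOn F D x (Icc 0 ((k + 1) * h)) := fun k => by
    induction k with
    | zero => simpa using hx 0
    | succ k ih =>
      have hunion := ih.union (hx (k + 1)) isClosed_Icc isClosed_Icc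
      push_cast at hunion ⊢
      rwa [Icc_union_Icc_eq_Icc (by positivity) (by nlinarith)] at hunion
  have hlt (t : ℝ) : t < (⌊t / h⌋₊ + 1) * h := (div_lt_iff₀ hh).mp (Nat.lt_floor_add_one _)
  refine ⟨fun t ht => (hIcc _).1 t ⟨ht, (hlt t).le⟩, fun t ht => ?_⟩
  exact ((hIcc _).2 t ⟨ht, (hlt t).le⟩).mono_of_mem_nhdsWithin
    (inter_mem_nhdsWithin (Ici 0) (Iic_mem_nhds (hlt t)))

theorem exists_isODESolutionOn_Ici_of_forall_Icc {h : ℝ} (hh : 0 < h)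
    (hD : ∀ x₀ ∈ D, ∃ x, x 0 = x₀ ∧ IsODESolutionOn F D x (Icc 0 h)) {x₀ : E} (hx₀ : x₀ ∈ D) :
    ∃ x, x 0 = x₀ ∧ IsODESolutionOn F D x (Ici 0) := by
  choose! φ hφ_zero hφ using hD
  let a : ℕ → E := fun k => (fun y => φ y h)^[k] x₀
  have ha_succ : ∀ k, a (k + 1) = φ (a k) h := fun k => Function.iterate_succ_apply' _ _ _
  have haD : ∀ k, a k ∈ D := fun k => by
    induction k with
    | zero => exact hx₀
    | succ k ih => exact ha_succ k ▸ (hφ _ ih).1 h ⟨hh.le, le_rfl⟩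
  let x : ℝ → E := fun t => φ (a ⌊t / h⌋₊) (t - ⌊t / h⌋₊ * h)
  have hx : ∀ k : ℕ, EqOn x (fun t => φ (a k) (t - k * h)) (Icc (k * h) ((k + 1) * h)) := by
    intro k t ht
    have hk : (k : ℝ) ≤ t / h := (le_div_iff₀ hh).mpr ht.1
    rcases ht.2.lt_or_eq with hlt | rfl
    · have hfloor : ⌊t / h⌋₊ = k :=
        (Nat.floor_eq_iff (k.cast_nonneg.trans hk)).mpr ⟨hk, (div_lt_iff₀ hh).mpr hlt⟩
      simp only [x, hfloor]
    · have hfloor : ⌊(k + 1) * h / h⌋₊ = k + 1 := by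
        rw [mul_div_cancel_right₀ _ hh.ne']
        exact_mod_cast Nat.floor_natCast (k + 1)
      have hsub : (k + 1) * h - k * h = h := by ring
      simp only [x, hfloor, hsub, Nat.cast_add_one, sub_self]
      rw [hφ_zero _ (haD _), ha_succ]
  refine ⟨x, ?_, .Ici_of_forall_nat hh fun k => ?_⟩
  · simpa [x, a] using hφ_zero x₀ hx₀
  · refine (((hφ _ (haD k)).comp_sub_const (k * h)).mono subset_rfl fun t ht => ?_).congr (hx k)
    exact ⟨sub_nonneg.mpr ht.1, by linarith [ht.2]⟩

end Solutions

section AsymptoticStability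

variable {E E' : Type*} [NormedAddCommGroup E] [NormedSpace ℝ E] [NormedAddCommGroup E']
  [NormedSpace ℝ E'] {F : E → E} {D : Set E} {e : E}

theorem isLocallyAsymptoticallyStable_iff_eventually :
    IsLocallyAsymptoticallyStable F D e ↔
      (∀ᶠ x₀ in 𝓝 e, ∃ x, x 0 = x₀ ∧ IsODESolutionOn F D x (Ici 0)) ∧
      (∀ U ∈ 𝓝 e, ∀ᶠ x₀ in 𝓝 e, ∀ (T : ℝ) (x : ℝ → E), x 0 = x₀ →
        IsODESolutionOn F D x (Ico 0 T) → ∀ t ∈ Ico 0 T, x t ∈ U) ∧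
      ∀ᶠ x₀ in 𝓝 e, ∀ x, x 0 = x₀ → IsODESolutionOn F D x (Ici 0) →
        Tendsto x atTop (𝓝 e) := by
  simp only [Metric.eventually_nhds_iff_ball]
  constructor
  · rintro ⟨hexists, hstable, δ, hδ, hattr⟩
    refine ⟨hexists, fun U hU => ?_, δ, hδ, ?_⟩
    · obtain ⟨ε, hε, hεU⟩ := Metric.mem_nhds_iff.mp hU
      obtain ⟨δ, hδ, hδε⟩ := hstable ε hε
      exact ⟨δ, hδ, fun _ hx₀ T x h0 hx t ht => hεU (hδε T x (h0 ▸ hx₀) hx t ht)⟩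
    · exact fun _ hx₀ x h0 hx => hattr x (h0 ▸ hx₀) hx
  · rintro ⟨hexists, hstable, δ, hδ, hattr⟩
    refine ⟨hexists, fun ε hε => ?_, δ, hδ, fun x hx₀ hx => hattr _ hx₀ x rfl hx⟩
    obtain ⟨δ, hδ, hδε⟩ := hstable _ (Metric.ball_mem_nhds e hε)
    exact ⟨δ, hδ, fun T x hx₀ hx => hδε _ hx₀ T x rfl hx⟩

theorem IsLocallyAsymptoticallyStable.of_continuousLinearEquiv (L : E ≃L[ℝ] E')
    (h : IsLocallyAsymptoticallyStable (L ∘ F ∘ L.symm) (L.symm ⁻¹' D) (L e)) :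
    IsLocallyAsymptoticallyStable F D e := by
  have hpush {x : ℝ → E} {s : Set ℝ} (hx : IsODESolutionOn F D x s) :
      IsODESolutionOn (L ∘ F ∘ L.symm) (L.symm ⁻¹' D) (L ∘ x) s :=
    hx.comp_continuousLinearMap (L := (L : E →L[ℝ] E')) (fun y hy => by simpa using hy)
      (fun y _ => by simp)
  have hpull {y : ℝ → E'} {s : Set ℝ}
      (hy : IsODESolutionOn (L ∘ F ∘ L.symm) (L.symm ⁻¹' D) y s) :
      IsODESolutionOn F D (L.symm ∘ y) s :=
    hy.comp_continuousLinearMap (L := (L.symm : E' →L[ℝ] E)) (fun y hy => hy)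
      (fun y _ => by simp)
  rw [isLocallyAsymptoticallyStable_iff_eventually] at h ⊢
  obtain ⟨hexists, hstable, hattr⟩ := h
  have hL : Tendsto L (𝓝 e) (𝓝 (L e)) := L.continuous.continuousAt
  refine ⟨(hL.eventually hexists).mono ?_, fun U hU => ?_, (hL.eventually hattr).mono ?_⟩
  · rintro x₀ ⟨y, hy₀, hy⟩
    exact ⟨L.symm ∘ y, by simp [hy₀], hpull hy⟩
  · have hU' : L.symm ⁻¹' U ∈ 𝓝 (L e) :=
      L.symm.continuous.continuousAt.preimage_mem_nhds (by simpa using hU)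
    refine (hL.eventually (hstable _ hU')).mono fun x₀ hx₀ T x h0 hx t ht => ?_
    simpa using hx₀ T (L ∘ x) (congrArg L h0) (hpush hx) t ht
  · intro x₀ hx₀ x h0 hx
    have hlim := (L.symm.continuous.tendsto _).comp (hx₀ (L ∘ x) (congrArg L h0) (hpush hx))
    simpa [Function.comp_def] using hlim

end AsymptoticStability

section DissipativeField

variable {E : Type*} [NormedAddCommGroup E] [InnerProductSpace ℝ E] {F : E → E} {e : E} {ω : ℝ}

theorem eventually_inner_sub_le_of_hasFDerivAt {A : E →L[ℝ] E} {ω' : ℝ} (hF : HasFDerivAt F A e)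
    (he : F e = 0) (hA : ∀ v, ⟪v, A v⟫_ℝ ≤ ω * ‖v‖ ^ 2) (hω : ω < ω') :
    ∀ᶠ x in 𝓝 e, ⟪x - e, F x⟫_ℝ ≤ ω' * ‖x - e‖ ^ 2 := by
  filter_upwards [hF.isLittleO.def (sub_pos.mpr hω)] with x hx
  rw [he, sub_zero] at hx
  calc ⟪x - e, F x⟫_ℝ = ⟪x - e, A (x - e)⟫_ℝ + ⟪x - e, F x - A (x - e)⟫_ℝ := by
        rw [← inner_add_right, add_sub_cancel]
    _ ≤ ω * ‖x - e‖ ^ 2 + ‖x - e‖ * ((ω' - ω) * ‖x - e‖) :=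
        add_le_add (hA _) ((real_inner_le_norm _ _).trans (by gcongr))
    _ = ω' * ‖x - e‖ ^ 2 := by ring

variable {r T : ℝ} {x : ℝ → E}

/-- Comparison of `‖x t - e‖ ^ 2` with `(ρ * exp (ω' * t)) ^ 2`: the latter stays below `r ^ 2`, and
wherever the two agree the former has the smaller derivative. -/
theorem norm_sub_le_mul_exp_of_inner_sub_le {ρ ω' : ℝ}
    (hF : ∀ y ∈ Metric.ball e r, ⟪y - e, F y⟫_ℝ ≤ ω * ‖y - e‖ ^ 2) (hω : ω < ω') (hω' : ω' ≤ 0)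
    (hρ : 0 < ρ) (hρr : ρ < r) (hx : IsIntegralCurveOn x (fun _ => F) (Icc 0 T))
    (hx₀ : ‖x 0 - e‖ ≤ ρ) : ∀ t ∈ Icc 0 T, ‖x t - e‖ ≤ ρ * Real.exp (ω' * t) := by
  have hderiv : ∀ t ∈ Icc 0 T, HasDerivWithinAt (fun t => ‖x t - e‖ ^ 2)
      (2 * ⟪x t - e, F (x t)⟫_ℝ) (Icc 0 T) t := fun t ht => ((hx t ht).sub_const e).norm_sq
  have hbound : ∀ t, HasDerivAt (fun t => (ρ * Real.exp (ω' * t)) ^ 2)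
      (2 * (ω' * (ρ * Real.exp (ω' * t)) ^ 2)) t := fun t => by
    have hlin : HasDerivAt (fun t => ω' * t) ω' t := by simpa using (hasDerivAt_id t).const_mul ω'
    exact ((hlin.exp.const_mul ρ).pow 2).congr_deriv (by simp; ring)
  have hsq : ∀ t ∈ Icc 0 T, ‖x t - e‖ ^ 2 ≤ (ρ * Real.exp (ω' * t)) ^ 2 :=
    image_le_of_deriv_right_lt_deriv_boundary
      (fun t ht => (hderiv t ht).continuousWithinAt)
      (fun t ht => (hderiv t ⟨ht.1, ht.2.le⟩).mono_of_mem_nhdsWithin (Icc_mem_nhdsGE_of_mem ht))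
      (by simpa using pow_le_pow_left₀ (norm_nonneg _) hx₀ 2) hbound fun t ht heq => by
        have hnorm : ‖x t - e‖ = ρ * Real.exp (ω' * t) :=
          (pow_left_inj₀ (norm_nonneg _) (by positivity) two_ne_zero).mp heq
        have hball : x t ∈ Metric.ball e r := mem_ball_iff_norm.mpr <| by
          rw [hnorm]
          exact (mul_le_of_le_one_right hρ.le <| Real.exp_le_one_iff.mpr <|
            mul_nonpos_of_nonpos_of_nonneg hω' ht.1).trans_lt hρr
        rw [← hnorm]
        have hpos : 0 < ‖x t - e‖ ^ 2 := by rw [hnorm]; positivity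
        linarith [hF _ hball, mul_lt_mul_of_pos_right hω hpos]
  exact fun t ht => le_of_sq_le_sq (hsq t ht) (by positivity)

theorem mem_ball_of_inner_sub_le {ρ : ℝ}
    (hF : ∀ y ∈ Metric.ball e r, ⟪y - e, F y⟫_ℝ ≤ ω * ‖y - e‖ ^ 2) (hω : ω < 0) (hρr : ρ ≤ r)
    (hx : IsIntegralCurveOn x (fun _ => F) (Icc 0 T)) (hx₀ : x 0 ∈ Metric.ball e ρ) :
    ∀ t ∈ Icc 0 T, x t ∈ Metric.ball e ρ := fun t ht => by
  obtain ⟨ρ', hxρ', hρ'⟩ := exists_between (mem_ball_iff_norm.mp hx₀)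
  have hle := norm_sub_le_mul_exp_of_inner_sub_le hF hω le_rfl ((norm_nonneg _).trans_lt hxρ')
    (hρ'.trans_le hρr) hx hxρ'.le t ht
  exact mem_ball_iff_norm.mpr ((by simpa using hle : ‖x t - e‖ ≤ ρ').trans_lt hρ')

theorem tendsto_of_inner_sub_le
    (hF : ∀ y ∈ Metric.ball e r, ⟪y - e, F y⟫_ℝ ≤ ω * ‖y - e‖ ^ 2) (hω : ω < 0)
    (hx : IsIntegralCurveOn x (fun _ => F) (Ici 0)) (hx₀ : x 0 ∈ Metric.ball e r) :
    Tendsto x atTop (𝓝 e) := by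
  obtain ⟨ρ, hxρ, hρr⟩ := exists_between (mem_ball_iff_norm.mp hx₀)
  obtain ⟨ω', hωω', hω'⟩ := exists_between hω
  have hdecay : ∀ t, 0 ≤ t → ‖x t - e‖ ≤ ρ * Real.exp (ω' * t) := fun t ht =>
    norm_sub_le_mul_exp_of_inner_sub_le hF hωω' hω'.le ((norm_nonneg _).trans_lt hxρ) hρr
      (hx.mono Icc_subset_Ici_self) hxρ.le t ⟨ht, le_rfl⟩
  have hexp : Tendsto (fun t => ρ * Real.exp (ω' * t)) atTop (𝓝 0) := by
    simpa using (Real.tendsto_exp_atBot.comp (tendsto_id.const_mul_atTop_of_neg hω')).const_mul ρ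
  rw [tendsto_iff_norm_sub_tendsto_zero]
  exact squeeze_zero' (.of_forall fun t => norm_nonneg _)
    (eventually_atTop.mpr ⟨0, hdecay⟩) hexp

theorem eventually_exists_isODESolutionOn_Ici_of_inner_sub_le [CompleteSpace E] {D : Set E}
    (hD : D ∈ 𝓝 e) (hFC : ContDiffAt ℝ 1 F e)
    (hF : ∀ᶠ y in 𝓝 e, ⟪y - e, F y⟫_ℝ ≤ ω * ‖y - e‖ ^ 2) (hω : ω < 0) :
    ∀ᶠ x₀ in 𝓝 e, ∃ x, x 0 = x₀ ∧ IsODESolutionOn F D x (Ici 0) := by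
  obtain ⟨ρ, hρ, h, hh, hlocal⟩ :=
    hFC.exists_forall_mem_closedBall_exists_eq_forall_mem_Ioo_hasDerivAt 0
  obtain ⟨r, hr, hball⟩ := Metric.mem_nhds_iff.mp <|
    inter_mem (inter_mem hD (Metric.closedBall_mem_nhds e hρ)) hF
  filter_upwards [Metric.ball_mem_nhds e hr] with x₀ hx₀
  have hstep : ∀ y₀ ∈ Metric.ball e r, ∃ y, y 0 = y₀ ∧
      IsODESolutionOn F (Metric.ball e r) y (Icc 0 (h / 2)) := fun y₀ hy₀ => by
    obtain ⟨y, rfl, hy⟩ := hlocal y₀ (hball hy₀).1.2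
    have hyI : IsIntegralCurveOn y (fun _ => F) (Icc 0 (h / 2)) := fun t ht =>
      (hy t ⟨by linarith [ht.1], by linarith [ht.2]⟩).hasDerivWithinAt
    exact ⟨y, rfl, mem_ball_of_inner_sub_le (fun y hy => (hball hy).2) hω le_rfl hyI hy₀, hyI⟩
  obtain ⟨x, hx0, hx⟩ := exists_isODESolutionOn_Ici_of_forall_Icc (half_pos hh) hstep hx₀
  exact ⟨x, hx0, hx.mono (fun y hy => (hball hy).1.1) subset_rfl⟩

theorem isLocallyAsymptoticallyStable_of_inner_fderiv_le [CompleteSpace E] {D : Set E}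
    (hD : D ∈ 𝓝 e) (hF : ContDiffAt ℝ 1 F e) (he : F e = 0) (hω : ω < 0)
    (hA : ∀ v, ⟪v, fderiv ℝ F e v⟫_ℝ ≤ ω * ‖v‖ ^ 2) :
    IsLocallyAsymptoticallyStable F D e := by
  obtain ⟨ω', hωω', hω'⟩ := exists_between hω
  have hnear := eventually_inner_sub_le_of_hasFDerivAt
    (hF.differentiableAt one_ne_zero).hasFDerivAt he hA hωω'
  obtain ⟨r, hr, hball⟩ := Metric.eventually_nhds_iff_ball.mp hnear
  refine isLocallyAsymptoticallyStable_iff_eventually.mpr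
    ⟨eventually_exists_isODESolutionOn_Ici_of_inner_sub_le hD hF hnear hω', fun U hU => ?_, ?_⟩
  · obtain ⟨ε, hε, hεU⟩ := Metric.mem_nhds_iff.mp hU
    filter_upwards [Metric.ball_mem_nhds e (lt_min hr hε)]
    rintro _ hx₀ T x rfl hx t ht
    have hxt := hx.2.mono fun s (hs : s ∈ Icc 0 t) => ⟨hs.1, hs.2.trans_lt ht.2⟩
    exact hεU <| Metric.ball_subset_ball (min_le_right r ε) <|
      mem_ball_of_inner_sub_le hball hω' (min_le_left r ε) hxt hx₀ t ⟨ht.1, le_rfl⟩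
  · filter_upwards [Metric.ball_mem_nhds e hr]
    rintro _ hx₀ x rfl hx
    exact tendsto_of_inner_sub_le hball hω' hx.2 hx₀

end DissipativeField

theorem isLocallyAsymptoticallyStable_of_hasEigenvalue_re_neg {E : Type*} [NormedAddCommGroup E]
    [NormedSpace ℝ E] [FiniteDimensional ℝ E] {F : E → E} {D : Set E} {e : E} (hD : D ∈ 𝓝 e)
    (hF : ContDiffAt ℝ 1 F e) (he : F e = 0)
    (hA : ∀ μ : ℂ, End.HasEigenvalue ((fderiv ℝ F e).toLinearMap.baseChange ℂ) μ → μ.re < 0) :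
    IsLocallyAsymptoticallyStable F D e := by
  obtain ⟨L, ω, hω, hL⟩ := exists_linearEquiv_logNormLE_of_baseChange hA
  let Φ := L.toContinuousLinearEquiv
  have hΦe : Φ.symm (Φ e) = e := Φ.symm_apply_apply e
  have hderiv : HasFDerivAt (Φ ∘ F ∘ Φ.symm)
      ((Φ : E →L[ℝ] _) ∘L fderiv ℝ F e ∘L (Φ.symm : _ →L[ℝ] E)) (Φ e) := by
    refine Φ.hasFDerivAt.comp _ (HasFDerivAt.comp _ ?_ Φ.symm.hasFDerivAt)
    rw [hΦe]
    exact (hF.differentiableAt one_ne_zero).hasFDerivAt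
  refine .of_continuousLinearEquiv Φ <| isLocallyAsymptoticallyStable_of_inner_fderiv_le
    (Φ.symm.continuous.continuousAt.preimage_mem_nhds (hΦe.symm ▸ hD)) ?_ (by simp [hΦe, he]) hω
    fun w => ?_
  · refine Φ.contDiff.contDiffAt.comp _ (ContDiffAt.comp _ ?_ Φ.symm.contDiff.contDiffAt)
    rwa [hΦe]
  · rw [hderiv.fderiv]
    simpa [Φ] using hL (L.symm w)

theorem hasEigenvalue_baseChange_iff_toLin' {K L V ι : Type*} [Field K] [Field L] [Algebra K L]
    [AddCommGroup V] [Module K V] [Fintype ι] [DecidableEq ι] (b : Basis ι K V) (A : End K V)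
    {μ : L} :
    End.HasEigenvalue (A.baseChange L) μ ↔
      End.HasEigenvalue (Matrix.toLin' ((LinearMap.toMatrix b b A).map (algebraMap K L))) μ := by
  have := b.finiteDimensional_of_finite
  rw [End.hasEigenvalue_iff_isRoot_charpoly, End.hasEigenvalue_iff_isRoot_charpoly,
    LinearMap.charpoly_baseChange, Matrix.charpoly_toLin', Matrix.charpoly_map,
    LinearMap.charpoly_toMatrix]

section PartialDerivatives

variable {ι Y Z : Type*} [Finite ι] [DecidableEq ι] [NormedAddCommGroup Y] [NormedSpace ℝ Y]
  [NormedAddCommGroup Z] [NormedSpace ℝ Z] {a : ι → ℝ} {y : Y}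

theorem deriv_update_fst_eq {f : (ι → ℝ) × Y → Z} {f' : (ι → ℝ) × Y →L[ℝ] Z}
    (hf : HasFDerivAt f f' (a, y)) (j : ι) :
    deriv (fun s => f (Function.update a j s, y)) (a j) = f' (Pi.single j 1, 0) :=
  have := Fintype.ofFinite ι
  (hf.comp_hasDerivAt_of_eq (a j) ((hasDerivAt_update a j (a j)).prodMk (hasDerivAt_const (a j) y))
    (by simp)).deriv

theorem deriv_update_snd_eq {f : Y × (ι → ℝ) → Z} {f' : Y × (ι → ℝ) →L[ℝ] Z}
    (hf : HasFDerivAt f f' (y, a)) (j : ι) :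
    deriv (fun s => f (y, Function.update a j s)) (a j) = f' (0, Pi.single j 1) :=
  have := Fintype.ofFinite ι
  (hf.comp_hasDerivAt_of_eq (a j) ((hasDerivAt_const (a j) y).prodMk (hasDerivAt_update a j (a j)))
    (by simp)).deriv

end PartialDerivatives

namespace StreamingModel

variable {N : ℕ} (m : StreamingModel N)

theorem isOpen_stateSpace : IsOpen m.stateSpace := by
  simp only [stateSpace, ofPred_forall]
  exact isOpen_iInter_of_finite fun i => m.isOpen_Q.preimage (by fun_prop)

theorem contDiff_choiceProb {X : Type*} [NormedAddCommGroup X] [NormedSpace ℝ X] {k : WithTop ℕ∞}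
    {n q : X → Fin N → ℝ} (hn : ContDiff ℝ k n) (hq : ContDiff ℝ k q) (i : Fin N) :
    ContDiff ℝ k fun x => m.choiceProb (n x) (q x) i := by
  have hweight : ∀ j, ContDiff ℝ k fun x =>
      Real.exp (m.α j * q x j - m.p j + m.β * n x j) := by fun_prop
  refine (hweight i).div (ContDiff.sum fun j _ => hweight j) fun x => ?_
  exact (Finset.sum_pos (fun j _ => Real.exp_pos _) ⟨i, Finset.mem_univ i⟩).ne'

theorem contDiff_marginalAudience (i : Fin N) :
    ContDiff ℝ 1 fun x : (Fin N → ℝ) × (Fin N → ℝ) => m.marginalAudience x.1 x.2 i := by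
  let G : ((Fin N → ℝ) × (Fin N → ℝ)) × ℝ → ℝ := fun z =>
    m.M * m.choiceProb z.1.1 (Function.update z.1.2 i z.2) i
  have hG : ContDiff ℝ 2 G := by
    refine contDiff_const.mul (m.contDiff_choiceProb (by fun_prop) (contDiff_pi.mpr fun j => ?_) i)
    rcases eq_or_ne j i with rfl | hj
    · simpa using contDiff_snd
    · simp only [Function.update_of_ne hj]
      fun_prop
  have hpartial : (fun x : (Fin N → ℝ) × (Fin N → ℝ) => m.marginalAudience x.1 x.2 i) =
      fun x => fderiv ℝ G (x, x.2 i) (0, 1) := funext fun x =>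
    ((hG.differentiable two_ne_zero _).hasFDerivAt.comp_hasDerivAt (x.2 i)
      ((hasDerivAt_const (x.2 i) x).prodMk (hasDerivAt_id (x.2 i)))).deriv
  have hG' : ContDiff ℝ 1 (fderiv ℝ G) := hG.fderiv_right one_add_one_eq_two.le
  rw [hpartial]
  exact (hG'.comp (by fun_prop)).clm_apply contDiff_const

theorem contDiffAt_vectorField {x : (Fin N → ℝ) × (Fin N → ℝ)} (hx : x ∈ m.stateSpace) :
    ContDiffAt ℝ 1 m.vectorField x := by
  refine ContDiffAt.prodMk (contDiffAt_pi.mpr fun i => ?_) (contDiffAt_pi.mpr fun i => ?_)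
  · have hP := (m.contDiff_choiceProb (k := 1) contDiff_fst contDiff_snd i).contDiffAt (x := x)
    exact contDiffAt_const.mul ((contDiffAt_const.mul hP).sub (by fun_prop))
  · have hc' : ContDiffAt ℝ 1 (deriv m.c) (x.2 i) :=
      (m.contDiffOn_c.deriv_of_isOpen m.isOpen_Q one_add_one_eq_two.le).contDiffAt
        (m.isOpen_Q.mem_nhds (hx i))
    have hcost : ContDiffAt ℝ 1 (fun y : (Fin N → ℝ) × (Fin N → ℝ) => deriv m.c (y.2 i)) x :=
      hc'.comp x (f := fun y : (Fin N → ℝ) × (Fin N → ℝ) => y.2 i) (by fun_prop)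
    exact contDiffAt_const.mul
      ((contDiffAt_const.mul (m.contDiff_marginalAudience i).contDiffAt).sub hcost)

theorem toMatrix_fderiv_vectorField {n q : Fin N → ℝ} (hx : (n, q) ∈ m.stateSpace) :
    LinearMap.toMatrix ((Pi.basisFun ℝ (Fin N)).prod (Pi.basisFun ℝ (Fin N)))
      ((Pi.basisFun ℝ (Fin N)).prod (Pi.basisFun ℝ (Fin N)))
      (fderiv ℝ m.vectorField (n, q)).toLinearMap = m.jacobian n q := by
  have hd := ((m.contDiffAt_vectorField hx).differentiableAt one_ne_zero).hasFDerivAt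
  have hviewer : ∀ i, HasFDerivAt (fun x => m.viewerRate x.1 x.2 i) _ (n, q) :=
    hasFDerivAt_pi'.mp hd.fst
  have hquality : ∀ i, HasFDerivAt (fun x => m.qualityRate x.1 x.2 i) _ (n, q) :=
    hasFDerivAt_pi'.mp hd.snd
  ext (i | i) (j | j)
  · simpa [jacobian, LinearMap.toMatrix_apply] using (deriv_update_fst_eq (hviewer i) j).symm
  · simpa [jacobian, LinearMap.toMatrix_apply] using (deriv_update_snd_eq (hviewer i) j).symm
  · simpa [jacobian, LinearMap.toMatrix_apply] using (deriv_update_fst_eq (hquality i) j).symm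
  · simpa [jacobian, LinearMap.toMatrix_apply] using (deriv_update_snd_eq (hquality i) j).symm

end StreamingModel

theorem theorem3 {N : ℕ} (m : StreamingModel N) (n q : Fin N → ℝ)
    (hsteady : m.IsSteadyState (n, q))
    (hJ : ∀ μ : ℂ, Module.End.HasEigenvalue
      (Matrix.toLin' ((m.jacobian n q).map (algebraMap ℝ ℂ))) μ → μ.re < 0) :
    IsLocallyAsymptoticallyStable m.vectorField m.stateSpace (n, q) := by
  refine isLocallyAsymptoticallyStable_of_hasEigenvalue_re_neg
    (m.isOpen_stateSpace.mem_nhds hsteady.1) (m.contDiffAt_vectorField hsteady.1) hsteady.2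
    fun μ hμ => hJ μ ?_
  rw [← m.toMatrix_fderiv_vectorField hsteady.1]
  exact (hasEigenvalue_baseChange_iff_toLin' _ _).mp hμ
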